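/- Let $k\ge 1$ and $1\le i\le k+1$ be integers, let $q$ be a complex number with $|q|<1$, and let $q^{1/2}$ be a fixed square root of $q$; write $q^{m/2}=(q^{1/2})^m$ for integers $m\ge 0$. Put $(a;q)_n=\prod_{j=0}^{n-1}(1-aq^j)$, $(a;q)_\infty=\prod_{j=0}^{\infty}(1-aq^j)$ and $(a_1,\dots,a_m;q)_\infty=(a_1;q)_\infty\cdots(a_m;q)_\infty$. For non-negative integers $n_1,\dots,n_k$ let $N_j=n_j+n_{j+1}+\cdots+n_k$ for $1\le j\le k$ and $N_j=0$ for $j>k$. Then the following series converges absolutely and $$\sum_{n_1,\dots,n_k\ge 0}\frac{q^{N_1^2+N_2^2+\cdots+N_k^2+N_i+N_{i+1}+\cdots+N_k}}{(q;q)_{n_1}\cdots(q;q)_{n_{k-1}}\,(-q^{1/2};q)_{n_k}\,(q^2;q^2)_{n_k}}=\frac{\bigl(q^{i},\,q^{\frac32+2k-i},\,q^{\frac32+2k};\,q^{\frac32+2k}\bigr)_\infty}{(q;q)_\infty}.$$ -/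

import Mathlib

noncomputable section

/-- The infinite `q`-shifted factorial `(a; q)_∞ = ∏_{j ≥ 0} (1 - a q^j)`, for `‖q‖ < 1`. -/
def qPochInf (a q : ℂ) : ℂ := ∏' j : ℕ, (1 - a * q ^ j)

/-- The finite `q`-shifted factorial `(a; q)_n = ∏_{j=0}^{n-1} (1 - a q^j)`. -/
def qPoch (a q : ℂ) (n : ℕ) : ℂ := ∏ j ∈ Finset.range n, (1 - a * q ^ j)

/-- The infinite product defining `(a; q)_∞` converges whenever `‖q‖ < 1`. -/
theorem multipliable_qPochInf (a : ℂ) {q : ℂ} (hq : ‖q‖ < 1) :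
    Multipliable fun j : ℕ => 1 - a * q ^ j := by
  have h : Summable fun j : ℕ => ‖-(a * q ^ j)‖ := by
    simpa [norm_mul, norm_pow] using
      (summable_geometric_of_lt_one (norm_nonneg q) hq).mul_left ‖a‖
  simpa [sub_eq_add_neg] using multipliable_one_add_of_summable h

/-- The entry `n_j` of a `k`-tuple `n = (n_1, …, n_k)`, numbered from `1` to `k`
(and `0` for any other `j`). -/
def entry {k : ℕ} (n : Fin k → ℕ) (j : ℕ) : ℕ :=
  if h : 1 ≤ j ∧ j ≤ k then n ⟨j - 1, by omega⟩ else 0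

/-- The tail sum `N_j = n_j + n_{j+1} + ⋯ + n_k`, which is `0` for `j > k`. -/
def tailSum {k : ℕ} (n : Fin k → ℕ) (j : ℕ) : ℕ := ∑ l ∈ Finset.Icc j k, entry n l

/-- The exponent `N_1² + ⋯ + N_k² + N_i + N_{i+1} + ⋯ + N_k`. -/
def sumExponent {k : ℕ} (i : ℕ) (n : Fin k → ℕ) : ℕ :=
  ∑ j ∈ Finset.Icc 1 k, tailSum n j ^ 2 + ∑ j ∈ Finset.Icc i k, tailSum n j

/-- The denominator
`(q; q)_{n_1} ⋯ (q; q)_{n_{k-1}} (-s; q)_{n_k} (q²; q²)_{n_k}`, where `s` stands for `q^{1/2}`. -/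
def sumDenominator {k : ℕ} (q s : ℂ) (n : Fin k → ℕ) : ℂ :=
  (∏ j ∈ Finset.Icc 1 (k - 1), qPoch q q (entry n j)) *
    qPoch (-s) q (entry n k) * qPoch (q ^ 2) (q ^ 2) (entry n k)

end

/-!
Write `β_N(w) = ∑_r w_r / ((q; q)_{N-r} (q; q)_{N+r})`, the `β` of the (bilateral) Bailey pair with
`α = w`. For theta weights `w_r = (-z)^r p^{r(r-1)/2}`, reflecting the summation index and lowering
the indices of the `q`-factorials gives `β_N = 1 / ((-q^{1/2}; q)_N (q²; q²)_N)` when `p = q^{3/2}`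
and `z = q`. Bailey's lemma sums `q^{M²} β_M / (q; q)_{N-M}` and multiplies `(p, z)` by `(q², q)`;
at `z = q` the same Bailey pair can be read relative to `a = q`, where Bailey's lemma sums
`q^{M²+M} β_M / (q; q)_{N-M}` and multiplies `(p, z)` by `(q², 1)`. Applying `k - i + 1` steps of
the second kind and then `i - 1` of the first evaluates the multisum truncated by
`1 / (q; q)_{N - N_1}` as `β_N` for `p = q^{3/2 + 2k}` and `z = q^i`. As `N → ∞` this becomes a
theta series divided by `(q; q)_∞`, and the Jacobi triple product finishes the proof.
-/

open Filter Topology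

section QPochhammer

variable {a q : ℂ}

theorem qPoch_succ (a q : ℂ) (n : ℕ) : qPoch a q (n + 1) = qPoch a q n * (1 - a * q ^ n) :=
  Finset.prod_range_succ _ _

theorem qPochInf_zero_left (q : ℂ) : qPochInf 0 q = 1 := by
  simp [qPochInf]

theorem tendsto_qPoch (a : ℂ) (hq : ‖q‖ < 1) :
    Tendsto (qPoch a q) atTop (𝓝 (qPochInf a q)) :=
  (multipliable_qPochInf a hq).hasProd.tendsto_prod_nat

theorem qPochInf_ne_zero (ha : ‖a‖ < 1) (hq : ‖q‖ < 1) : qPochInf a q ≠ 0 := by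
  have norm_term_lt (j : ℕ) : ‖a * q ^ j‖ < 1 := by
    rw [norm_mul, norm_pow]
    exact mul_lt_one_of_nonneg_of_lt_one_left (norm_nonneg _) ha
      (pow_le_one₀ (norm_nonneg _) hq.le)
  have factor_ne_zero (j : ℕ) : 1 + -(a * q ^ j) ≠ 0 := by
    rw [← sub_eq_add_neg, sub_ne_zero]
    intro h
    simpa [← h] using norm_term_lt j
  have summable_norm : Summable fun j : ℕ => ‖-(a * q ^ j)‖ := by
    simpa [norm_mul, norm_pow] using
      (summable_geometric_of_lt_one (norm_nonneg q) hq).mul_left ‖a‖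
  simpa [qPochInf, sub_eq_add_neg] using
    tprod_one_add_ne_zero_of_summable factor_ne_zero summable_norm

theorem exists_norm_inv_qPoch_le (ha : ‖a‖ < 1) (hq : ‖q‖ < 1) :
    ∃ K : ℝ, ∀ n, ‖(qPoch a q n)⁻¹‖ ≤ K := by
  obtain ⟨K, hK⟩ := ((tendsto_qPoch a hq).inv₀ (qPochInf_ne_zero ha hq)).norm.bddAbove_range
  exact ⟨K, fun n => hK ⟨n, rfl⟩⟩

/-- The reciprocal `q`-factorial `1 / (q; q)_m`, extended by `0` to negative `m`, so that
bilateral sums of products of these terminate by themselves. -/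
noncomputable def invQPoch (q : ℂ) (m : ℤ) : ℂ :=
  if 0 ≤ m then (qPoch q q m.toNat)⁻¹ else 0

theorem invQPoch_of_neg (q : ℂ) {m : ℤ} (hm : m < 0) : invQPoch q m = 0 :=
  if_neg (not_le.mpr hm)

theorem invQPoch_natCast (q : ℂ) (m : ℕ) : invQPoch q m = (qPoch q q m)⁻¹ := by
  simp [invQPoch]

theorem invQPoch_zero (q : ℂ) : invQPoch q 0 = 1 := by
  simp [invQPoch, qPoch]

theorem not_isOfFinOrder_of_norm_lt_one (hq : ‖q‖ < 1) : ¬IsOfFinOrder q :=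
  fun h => hq.ne h.norm_eq_one

theorem one_sub_pow_ne_zero (hq : ¬IsOfFinOrder q) {n : ℕ} (hn : n ≠ 0) : 1 - q ^ n ≠ 0 :=
  sub_ne_zero.mpr fun h =>
    hq (isOfFinOrder_iff_pow_eq_one.mpr ⟨n, Nat.pos_of_ne_zero hn, h.symm⟩)

theorem invQPoch_sub_one (hq : ¬IsOfFinOrder q) (m : ℤ) :
    invQPoch q (m - 1) = (1 - q ^ m) * invQPoch q m := by
  rcases lt_trichotomy m 0 with h | rfl | h
  · rw [invQPoch_of_neg q h, invQPoch_of_neg q (by omega), mul_zero]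
  · simp [invQPoch]
  · obtain ⟨n, rfl⟩ : ∃ n : ℕ, m = (n + 1 : ℕ) := ⟨(m - 1).toNat, by omega⟩
    rw [show ((n + 1 : ℕ) : ℤ) - 1 = (n : ℕ) by push_cast; ring, invQPoch_natCast,
      invQPoch_natCast, qPoch_succ, zpow_natCast, ← pow_succ', mul_inv, mul_left_comm,
      mul_inv_cancel₀ (one_sub_pow_ne_zero hq n.succ_ne_zero), mul_one]

theorem one_sub_zpow_add_mul_invQPoch (hq : ¬IsOfFinOrder q) (hq0 : q ≠ 0) (m n : ℤ) :
    (1 - q ^ (m + n)) * (invQPoch q m * invQPoch q n) =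
      invQPoch q (m - 1) * invQPoch q n + q ^ m * (invQPoch q m * invQPoch q (n - 1)) := by
  rw [invQPoch_sub_one hq, invQPoch_sub_one hq, zpow_add₀ hq0]
  ring

theorem exists_norm_invQPoch_le (hq : ‖q‖ < 1) : ∃ K : ℝ, ∀ m, ‖invQPoch q m‖ ≤ K := by
  obtain ⟨K, hK⟩ := exists_norm_inv_qPoch_le hq hq
  refine ⟨K, fun m => ?_⟩
  rw [invQPoch]
  split_ifs
  · exact hK _
  · simpa using (norm_nonneg _).trans (hK 0)

theorem tendsto_invQPoch (hq : ‖q‖ < 1) :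
    Tendsto (invQPoch q) atTop (𝓝 (qPochInf q q)⁻¹) := by
  have toNat_tendsto : Tendsto Int.toNat atTop atTop :=
    tendsto_atTop_atTop.mpr fun b => ⟨b, fun a ha => by omega⟩
  refine (((tendsto_qPoch q hq).inv₀ (qPochInf_ne_zero hq hq)).comp toNat_tendsto).congr' ?_
  filter_upwards [eventually_ge_atTop 0] with m hm
  simp [invQPoch, hm]

theorem tendsto_invQPoch_natCast_add (hq : ‖q‖ < 1) (d : ℤ) :
    Tendsto (fun N : ℕ => invQPoch q (N + d)) atTop (𝓝 (qPochInf q q)⁻¹) :=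
  (tendsto_invQPoch hq).comp
    (tendsto_atTop_add_const_right _ d tendsto_natCast_atTop_atTop)

end QPochhammer

section BaileySum

variable {q : ℂ}

/-- The bilateral sum `∑_r w_r / ((q; q)_{A-r} (q; q)_{C+r})`, which has finitely many nonzero
terms. For `A = N + c` and `C = N` it is, up to normalisation, the `β_N` of the Bailey pair
relative to `a = q^c` whose `α` is the symmetrisation of `w` under `r ↦ c - r`. -/
noncomputable def baileySum (q : ℂ) (w : ℤ → ℂ) (A C : ℤ) : ℂ :=
  ∑' r : ℤ, w r * (invQPoch q (A - r) * invQPoch q (C + r))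

theorem invQPoch_mul_invQPoch_eq_zero (q : ℂ) {m n : ℤ} (h : m < 0 ∨ n < 0) :
    invQPoch q m * invQPoch q n = 0 := by
  rcases h with h | h <;> simp [invQPoch_of_neg q h]

theorem summable_baileySum (q : ℂ) (w : ℤ → ℂ) (A C : ℤ) :
    Summable fun r : ℤ => w r * (invQPoch q (A - r) * invQPoch q (C + r)) := by
  refine summable_of_ne_finset_zero (s := Finset.Icc (-C) A) fun r hr => ?_
  rw [Finset.mem_Icc] at hr
  rw [invQPoch_mul_invQPoch_eq_zero q (by omega), mul_zero]

theorem baileySum_eq_zero_of_add_neg (q : ℂ) (w : ℤ → ℂ) {A C : ℤ} (h : A + C < 0) :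
    baileySum q w A C = 0 := by
  rw [baileySum, ← tsum_zero (α := ℂ) (β := ℤ)]
  refine tsum_congr fun r => ?_
  rw [invQPoch_mul_invQPoch_eq_zero q (by omega), mul_zero]

theorem baileySum_zero_zero (q : ℂ) (w : ℤ → ℂ) : baileySum q w 0 0 = w 0 := by
  rw [baileySum, tsum_eq_single 0 fun r hr => by
    rw [invQPoch_mul_invQPoch_eq_zero q (by omega), mul_zero]]
  simp [invQPoch_zero]

theorem baileySum_const_mul (q x : ℂ) (w : ℤ → ℂ) (A C : ℤ) :
    baileySum q (fun r => x * w r) A C = x * baileySum q w A C := by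
  simp only [baileySum, mul_assoc, tsum_mul_left]

theorem baileySum_comp_add (q : ℂ) (w : ℤ → ℂ) (A C d : ℤ) :
    baileySum q w A C = baileySum q (fun r => w (r + d)) (A - d) (C + d) := by
  rw [baileySum, baileySum, ← (Equiv.addRight d).tsum_eq]
  refine tsum_congr fun r => ?_
  rw [Equiv.coe_addRight]
  congr 3 <;> ring

theorem baileySum_comp_sub_left (q : ℂ) (w : ℤ → ℂ) (A C d : ℤ) :
    baileySum q w A C = baileySum q (fun r => w (d - r)) (C + d) (A - d) := by
  rw [baileySum, baileySum, ← (Equiv.subLeft d).tsum_eq]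
  refine tsum_congr fun r => ?_
  rw [Equiv.subLeft_apply, mul_comm (invQPoch q (A - (d - r)))]
  congr 3 <;> ring

theorem baileySum_lower_left (hq : ¬IsOfFinOrder q) (hq0 : q ≠ 0) (w : ℤ → ℂ) (A C : ℤ) :
    baileySum q w A C = baileySum q w (A + 1) C -
      q ^ (A + 1) * baileySum q (fun r => w r * q⁻¹ ^ r) (A + 1) C := by
  rw [← baileySum_const_mul, baileySum, baileySum, baileySum,
    ← (summable_baileySum _ _ _ _).tsum_sub (summable_baileySum _ _ _ _)]
  refine tsum_congr fun r => ?_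
  rw [show A - r = A + 1 - r - 1 by ring, invQPoch_sub_one hq, zpow_sub₀ hq0, inv_zpow]
  ring

theorem baileySum_lower_right (hq : ¬IsOfFinOrder q) (hq0 : q ≠ 0) (w : ℤ → ℂ) (A C : ℤ) :
    baileySum q w A C = baileySum q w A (C + 1) -
      q ^ (C + 1) * baileySum q (fun r => w r * q ^ r) A (C + 1) := by
  rw [← baileySum_const_mul, baileySum, baileySum, baileySum,
    ← (summable_baileySum _ _ _ _).tsum_sub (summable_baileySum _ _ _ _)]
  refine tsum_congr fun r => ?_
  rw [show C + r = C + 1 + r - 1 by ring, invQPoch_sub_one hq, zpow_add₀ hq0]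
  ring

theorem one_sub_zpow_mul_baileySum_add_one (hq : ¬IsOfFinOrder q) (hq0 : q ≠ 0) (w : ℤ → ℂ)
    (A C : ℤ) :
    (1 - q ^ (A + 1 + C)) * baileySum q w (A + 1) C =
      baileySum q w A C + baileySum q (fun r => q ^ (A - r) * w (r + 1)) A C := by
  have pascal (r : ℤ) : (1 - q ^ (A + 1 + C)) *
      (w r * (invQPoch q (A + 1 - r) * invQPoch q (C + r))) =
      w r * (invQPoch q (A - r) * invQPoch q (C + r)) +
        q ^ (A + 1 - r) * w r * (invQPoch q (A + 1 - r) * invQPoch q (C - 1 + r)) := by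
    have h := one_sub_zpow_add_mul_invQPoch hq hq0 (A + 1 - r) (C + r)
    rw [show A + 1 - r + (C + r) = A + 1 + C by ring, show A + 1 - r - 1 = A - r by ring,
      show C + r - 1 = C - 1 + r by ring] at h
    linear_combination w r * h
  have shift : baileySum q (fun r => q ^ (A + 1 - r) * w r) (A + 1) (C - 1) =
      baileySum q (fun r => q ^ (A - r) * w (r + 1)) A C := by
    rw [baileySum_comp_add _ _ _ _ 1]
    simp only [add_sub_add_right_eq_sub, add_sub_cancel_right, sub_add_cancel]
  rw [← shift, baileySum, ← tsum_mul_left, tsum_congr pascal,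
    (summable_baileySum _ _ _ _).tsum_add (summable_baileySum _ _ _ _), baileySum, baileySum]

theorem tendsto_baileySum (hq : ‖q‖ < 1) {w : ℤ → ℂ} (hw : Summable w) :
    Tendsto (fun N : ℕ => baileySum q w N N) atTop
      (𝓝 ((∑' r, w r) * ((qPochInf q q)⁻¹ * (qPochInf q q)⁻¹))) := by
  obtain ⟨K, hK⟩ := exists_norm_invQPoch_le hq
  rw [← tsum_mul_right]
  refine tendsto_tsum_of_dominated_convergence (hw.norm.mul_right (K * K)) (fun r => ?_)
    (Eventually.of_forall fun N r => ?_)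
  · exact ((tendsto_invQPoch_natCast_add hq (-r)).mul
      (tendsto_invQPoch_natCast_add hq r)).const_mul _
  · rw [norm_mul, norm_mul]
    have hK0 : 0 ≤ K := (norm_nonneg _).trans (hK 0)
    gcongr <;> exact hK _

end BaileySum

section BaileyLemma

variable {q : ℂ}

theorem q_vandermonde_durfee (hq : ¬IsOfFinOrder q) (hq0 : q ≠ 0) (A B : ℤ) :
    baileySum q (fun m => q ^ (m * (m + B)) * invQPoch q (m + B)) A 0 =
      invQPoch q A * invQPoch q (A + B) := by
  rcases lt_or_ge A 0 with hA | hA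
  · rw [baileySum_eq_zero_of_add_neg q _ (by omega), invQPoch_of_neg q hA, zero_mul]
  lift A to ℕ using hA
  induction A generalizing B with
  | zero => simp [baileySum_zero_zero, invQPoch_zero]
  | succ A ih =>
    have hA : 1 - q ^ ((A : ℤ) + 1) ≠ 0 := by
      exact_mod_cast one_sub_pow_ne_zero hq A.succ_ne_zero
    have shift (m : ℤ) :
        q ^ (A - m) * (q ^ ((m + 1) * (m + 1 + B)) * invQPoch q (m + 1 + B)) =
          q ^ (A + 1 + B) * (q ^ (m * (m + (B + 1))) * invQPoch q (m + (B + 1))) := by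
      rw [← mul_assoc, ← mul_assoc, ← zpow_add₀ hq0, ← zpow_add₀ hq0]
      congr 2 <;> ring
    have lower_A : invQPoch q A = (1 - q ^ ((A : ℤ) + 1)) * invQPoch q (A + 1) := by
      rw [← invQPoch_sub_one hq, add_sub_cancel_right]
    have lower_AB :
        invQPoch q (A + B) = (1 - q ^ ((A : ℤ) + 1 + B)) * invQPoch q (A + 1 + B) := by
      rw [← invQPoch_sub_one hq, add_sub_right_comm, add_sub_cancel_right]
    apply mul_left_cancel₀ hA
    have pascal := one_sub_zpow_mul_baileySum_add_one hq hq0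
      (fun m => q ^ (m * (m + B)) * invQPoch q (m + B)) A 0
    simp only [shift, add_zero] at pascal
    push_cast
    rw [pascal, baileySum_const_mul, ih B, ih (B + 1),
      show (A : ℤ) + (B + 1) = A + 1 + B by ring, lower_A, lower_AB]
    ring

theorem tsum_int_eq_sum_range {α : Type*} [AddCommMonoid α] [TopologicalSpace α] {f : ℤ → α}
    {N : ℕ} (hf : ∀ M : ℤ, M < 0 ∨ N < M → f M = 0) :
    ∑' M, f M = ∑ M ∈ Finset.range (N + 1), f M := by
  rw [tsum_eq_sum (s := (Finset.range (N + 1)).map Nat.castEmbedding) fun M hM => hf M ?_,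
    Finset.sum_map]
  · rfl
  · by_contra! h
    exact hM (Finset.mem_map.mpr ⟨M.toNat, Finset.mem_range.mpr (by omega),
      Int.toNat_of_nonneg h.1⟩)

theorem sum_bailey_kernel (hq : ¬IsOfFinOrder q) (hq0 : q ≠ 0) {c : ℤ} (hc : c ≤ 1) (N : ℕ)
    (r : ℤ) :
    ∑ M ∈ Finset.range (N + 1), q ^ ((M : ℤ) * (M + c)) * invQPoch q (N - M) *
        (invQPoch q (M + c - r) * invQPoch q (M + r)) =
      q ^ (r * (r - c)) * (invQPoch q (N + c - r) * invQPoch q (N + r)) := by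
  have factor (m : ℤ) : q ^ ((m + -r) * (m + -r + c)) * invQPoch q (m + -r + c - r) =
      q ^ (r * (r - c)) * (q ^ (m * (m + (c - 2 * r))) * invQPoch q (m + (c - 2 * r))) := by
    rw [← mul_assoc, ← zpow_add₀ hq0]
    congr 2 <;> ring
  have durfee := q_vandermonde_durfee hq hq0 (N + r) (c - 2 * r)
  rw [show (N : ℤ) + r + (c - 2 * r) = N + c - r by ring] at durfee
  calc
    _ = baileySum q (fun M => q ^ (M * (M + c)) * invQPoch q (M + c - r)) N r := by
      rw [baileySum, tsum_int_eq_sum_range]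
      · exact Finset.sum_congr rfl fun M _ => by rw [add_comm r]; ring
      · rintro M (hM | hM)
        -- The two indices add up to `2 * M + c < 0`.
        · have vanish : invQPoch q (M + c - r) * invQPoch q (r + M) = 0 :=
            invQPoch_mul_invQPoch_eq_zero q (by omega)
          linear_combination q ^ (M * (M + c)) * invQPoch q (N - M) * vanish
        · rw [invQPoch_of_neg q (by omega : (N : ℤ) - M < 0)]
          ring
    _ = q ^ (r * (r - c)) * (invQPoch q (N + c - r) * invQPoch q (N + r)) := by
      rw [baileySum_comp_add _ _ _ _ (-r)]
      simp only [factor]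
      rw [baileySum_const_mul, add_neg_cancel, sub_neg_eq_add, durfee, mul_comm (invQPoch q _)]

theorem bailey_lemma (hq : ¬IsOfFinOrder q) (hq0 : q ≠ 0) {c : ℤ} (hc : c ≤ 1) (w : ℤ → ℂ)
    (N : ℕ) :
    ∑ M ∈ Finset.range (N + 1), q ^ ((M : ℤ) * (M + c)) * invQPoch q (N - M) *
        baileySum q w (M + c) M =
      baileySum q (fun r => q ^ (r * (r - c)) * w r) (N + c) N := by
  simp only [baileySum, ← tsum_mul_left]
  rw [← Summable.tsum_finsetSum fun (M : ℕ) _ => (summable_baileySum q w (M + c) M).mul_left _]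
  refine tsum_congr fun r => ?_
  rw [mul_right_comm, ← sum_bailey_kernel hq hq0 hc, Finset.sum_mul]
  exact Finset.sum_congr rfl fun M _ => by ring

end BaileyLemma

section Theta

variable {p z : ℂ}

/-- The triangular number `r (r - 1) / 2` of an integer `r`; the division is exact. -/
def triangular (r : ℤ) : ℤ := r * (r - 1) / 2

theorem two_mul_triangular (r : ℤ) : 2 * triangular r = r * (r - 1) :=
  Int.mul_ediv_cancel' (Int.even_mul_pred_self r).two_dvd

/-- The term `(-z)^r p^{r (r - 1) / 2}` of the theta series with nome `p`. -/
noncomputable def thetaTerm (p z : ℂ) (r : ℤ) : ℂ := (-z) ^ r * p ^ triangular r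

theorem thetaTerm_zero (p z : ℂ) : thetaTerm p z 0 = 1 := by
  simp [thetaTerm, triangular]

theorem thetaTerm_ne_zero (hp : p ≠ 0) (hz : z ≠ 0) (r : ℤ) : thetaTerm p z r ≠ 0 :=
  mul_ne_zero (zpow_ne_zero _ (neg_ne_zero.mpr hz)) (zpow_ne_zero _ hp)

theorem thetaTerm_mul_zpow (p z y : ℂ) (r : ℤ) :
    thetaTerm p z r * y ^ r = thetaTerm p (z * y) r := by
  rw [thetaTerm, thetaTerm, ← neg_mul, mul_zpow]
  ring

theorem thetaTerm_add_one (hp : p ≠ 0) (hz : z ≠ 0) (r : ℤ) :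
    thetaTerm p z (r + 1) = -z * p ^ r * thetaTerm p z r := by
  have htri : triangular (r + 1) = r + triangular r := by
    linarith [two_mul_triangular r, two_mul_triangular (r + 1)]
  rw [thetaTerm, thetaTerm, htri, zpow_add₀ hp, zpow_add_one₀ (neg_ne_zero.mpr hz)]
  ring

theorem thetaTerm_neg (hp : p ≠ 0) (z : ℂ) (r : ℤ) :
    thetaTerm p z (-r) = thetaTerm p (p / z) r := by
  have htri : triangular (-r) = r + triangular r := by
    linarith [two_mul_triangular r, two_mul_triangular (-r)]
  rw [thetaTerm, thetaTerm, htri, zpow_add₀ hp, zpow_neg, ← inv_zpow, ← mul_assoc, ← mul_zpow,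
    inv_neg, neg_mul, mul_comm z⁻¹, ← div_eq_mul_inv]

theorem thetaTerm_one_sub (p : ℂ) (hz : z ≠ 0) (r : ℤ) :
    thetaTerm p z (1 - r) = -z * thetaTerm p z⁻¹ r := by
  have htri : triangular (1 - r) = triangular r := by
    linarith [two_mul_triangular r, two_mul_triangular (1 - r)]
  rw [thetaTerm, thetaTerm, htri, zpow_sub₀ (neg_ne_zero.mpr hz), zpow_one, ← inv_neg, inv_zpow]
  ring

theorem zpow_mul_thetaTerm {q : ℂ} (hq : q ≠ 0) (p z : ℂ) (c r : ℤ) :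
    q ^ (r * (r - c)) * thetaTerm p z r = thetaTerm (p * q ^ 2) (z * q ^ (1 - c)) r := by
  have hexp : r * (r - c) = (1 - c) * r + 2 * triangular r := by
    rw [two_mul_triangular]
    ring
  rw [thetaTerm, thetaTerm, hexp, zpow_add₀ hq, zpow_mul, zpow_mul, ← neg_mul, mul_zpow, mul_zpow]
  norm_cast
  ring

theorem summable_thetaTerm_natCast (hp : p ≠ 0) (hp1 : ‖p‖ < 1) (hz : z ≠ 0) :
    Summable fun n : ℕ => thetaTerm p z n := by
  refine summable_of_ratio_test_tendsto_lt_one zero_lt_one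
    (Eventually.of_forall fun n => thetaTerm_ne_zero hp hz n) ?_
  have ratio (n : ℕ) :
      ‖thetaTerm p z (n + 1 : ℕ)‖ / ‖thetaTerm p z n‖ = ‖z‖ * ‖p‖ ^ n := by
    rw [Nat.cast_add_one, thetaTerm_add_one hp hz, norm_mul, mul_div_assoc,
      div_self (norm_ne_zero_iff.mpr (thetaTerm_ne_zero hp hz n))]
    simp
  simp only [ratio]
  simpa using (tendsto_pow_atTop_nhds_zero_of_lt_one (norm_nonneg p) hp1).const_mul ‖z‖

theorem summable_thetaTerm (hp : p ≠ 0) (hp1 : ‖p‖ < 1) (hz : z ≠ 0) :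
    Summable (thetaTerm p z) := by
  refine Summable.of_nat_of_neg (summable_thetaTerm_natCast hp hp1 hz) ?_
  simp only [thetaTerm_neg hp]
  exact summable_thetaTerm_natCast hp hp1 (div_ne_zero hp hz)

end Theta

section JacobiTripleProduct

variable {p z : ℂ}

theorem baileySum_thetaTerm_neg (q : ℂ) (hp : p ≠ 0) (z : ℂ) (A C : ℤ) :
    baileySum q (thetaTerm p z) A C = baileySum q (thetaTerm p (p / z)) C A := by
  rw [baileySum_comp_sub_left q _ A C 0]
  simp only [zero_sub, thetaTerm_neg hp, add_zero, sub_zero]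

theorem one_sub_zpow_mul_baileySum_thetaTerm (hp : ¬IsOfFinOrder p) (hp0 : p ≠ 0) (hz : z ≠ 0)
    (A C : ℤ) :
    (1 - p ^ (A + 1 + C)) * baileySum p (thetaTerm p z) (A + 1) C =
      (1 - z * p ^ A) * baileySum p (thetaTerm p z) A C := by
  have shift (r : ℤ) : p ^ (A - r) * thetaTerm p z (r + 1) = -(z * p ^ A) * thetaTerm p z r := by
    rw [thetaTerm_add_one hp0 hz, zpow_sub₀ hp0]
    field_simp [zpow_ne_zero r hp0]
  rw [one_sub_zpow_mul_baileySum_add_one hp hp0]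
  simp only [shift]
  rw [baileySum_const_mul]
  ring

theorem baileySum_thetaTerm_mul_qPoch_add (hp : ¬IsOfFinOrder p) (hp0 : p ≠ 0) (hz : z ≠ 0)
    (n m : ℕ) :
    baileySum p (thetaTerm p z) n m * qPoch p p (n + m) =
      qPoch z p n * (baileySum p (thetaTerm p z) 0 m * qPoch p p m) := by
  induction n with
  | zero => simp [qPoch]
  | succ n ih =>
    have step := one_sub_zpow_mul_baileySum_thetaTerm hp hp0 hz n m
    rw [show (n : ℤ) + 1 + m = (n + m + 1 : ℕ) by push_cast; ring, zpow_natCast,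
      zpow_natCast] at step
    rw [Nat.add_right_comm, qPoch_succ, qPoch_succ, mul_right_comm _ _ (baileySum _ _ 0 _ * _),
      ← ih, ← pow_succ', Nat.cast_add_one]
    linear_combination qPoch p p (n + m) * step

theorem finite_jacobi_triple_product (hp : ¬IsOfFinOrder p) (hp0 : p ≠ 0) (hz : z ≠ 0)
    (n m : ℕ) :
    baileySum p (thetaTerm p z) n m * qPoch p p (n + m) = qPoch z p n * qPoch (p / z) p m := by
  have right := baileySum_thetaTerm_mul_qPoch_add hp hp0 (div_ne_zero hp0 hz) m 0
  rw [Nat.cast_zero, baileySum_zero_zero, thetaTerm_zero, add_zero] at right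
  rw [baileySum_thetaTerm_mul_qPoch_add hp hp0 hz, baileySum_thetaTerm_neg p hp0, right]
  simp [qPoch]

theorem jacobi_triple_product (hp : ‖p‖ < 1) (hp0 : p ≠ 0) (hz : z ≠ 0) :
    ∑' r, thetaTerm p z r = qPochInf z p * qPochInf (p / z) p * qPochInf p p := by
  have two_mul_tendsto : Tendsto (fun n : ℕ => n + n) atTop atTop :=
    tendsto_atTop_mono (fun n => Nat.le_add_left n n) tendsto_id
  have sum_side := (tendsto_baileySum hp (summable_thetaTerm hp0 hp hz)).mul
    ((tendsto_qPoch p hp).comp two_mul_tendsto)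
  have product_side := (tendsto_qPoch z hp).mul (tendsto_qPoch (p / z) hp)
  have limits_eq := tendsto_nhds_unique (sum_side.congr fun n =>
    finite_jacobi_triple_product (not_isOfFinOrder_of_norm_lt_one hp) hp0 hz n n) product_side
  have h0 := qPochInf_ne_zero hp hp
  rw [← limits_eq]
  field_simp

end JacobiTripleProduct

section BaileyPair

variable {q : ℂ}

theorem baileySum_thetaTerm_one_sub (q p : ℂ) {z : ℂ} (hz : z ≠ 0) (A C : ℤ) :
    baileySum q (thetaTerm p z) A C = -z * baileySum q (thetaTerm p z⁻¹) (C + 1) (A - 1) := by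
  rw [baileySum_comp_sub_left q _ A C 1]
  simp only [thetaTerm_one_sub p hz]
  rw [baileySum_const_mul]

theorem baileySum_thetaTerm_lower_left (hq : ¬IsOfFinOrder q) (hq0 : q ≠ 0) (p z : ℂ)
    (A C : ℤ) :
    baileySum q (thetaTerm p z) A C = baileySum q (thetaTerm p z) (A + 1) C -
      q ^ (A + 1) * baileySum q (thetaTerm p (z / q)) (A + 1) C := by
  rw [baileySum_lower_left hq hq0]
  simp only [thetaTerm_mul_zpow, div_eq_mul_inv]

theorem baileySum_thetaTerm_lower_right (hq : ¬IsOfFinOrder q) (hq0 : q ≠ 0) (p z : ℂ)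
    (A C : ℤ) :
    baileySum q (thetaTerm p z) A C = baileySum q (thetaTerm p z) A (C + 1) -
      q ^ (C + 1) * baileySum q (thetaTerm p (z * q)) A (C + 1) := by
  rw [baileySum_lower_right hq hq0]
  simp only [thetaTerm_mul_zpow]

theorem baileySum_thetaTerm_one_eq_zero (q p : ℂ) (N : ℤ) :
    baileySum q (thetaTerm p 1) (N + 1) N = 0 := by
  have h := baileySum_thetaTerm_one_sub q p one_ne_zero (N + 1) N
  rw [inv_one, add_sub_cancel_right] at h
  linear_combination h / 2

-- A Bailey pair relative to `1` is thereby one relative to `q`.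
theorem baileySum_thetaTerm_self_succ (hq : ¬IsOfFinOrder q) (hq0 : q ≠ 0) (p : ℂ) (N : ℤ) :
    baileySum q (thetaTerm p q) N N = baileySum q (thetaTerm p q) (N + 1) N := by
  rw [baileySum_thetaTerm_lower_left hq hq0, div_self hq0, baileySum_thetaTerm_one_eq_zero,
    mul_zero, sub_zero]

theorem baileySum_thetaTerm_sqrt_lower_left {s : ℂ} (hs : ¬IsOfFinOrder s) (hs0 : s ≠ 0) (p : ℂ)
    (N : ℤ) :
    baileySum (s ^ 2) (thetaTerm p s) N N =
      (1 + s * (s ^ 2) ^ N) * baileySum (s ^ 2) (thetaTerm p s) (N + 1) N := by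
  have lower := baileySum_thetaTerm_lower_left (fun h => hs (h.of_pow two_ne_zero))
    (pow_ne_zero 2 hs0) p s N N
  have reflect := baileySum_thetaTerm_one_sub (s ^ 2) p hs0 (N + 1) N
  rw [show s / s ^ 2 = s⁻¹ by field_simp, zpow_add_one₀ (pow_ne_zero 2 hs0)] at lower
  rw [add_sub_cancel_right] at reflect
  linear_combination lower - s * (s ^ 2) ^ N * reflect

theorem baileySum_thetaTerm_mul_lower_right (hq : ¬IsOfFinOrder q) (hq0 : q ≠ 0) {z : ℂ}
    (hz : z ≠ 0) (N : ℤ) :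
    baileySum q (thetaTerm (z * q) z) (N + 1) N =
      (1 - (q ^ 2) ^ (N + 1)) * baileySum q (thetaTerm (z * q) z) (N + 1) (N + 1) := by
  have hp0 : z * q ≠ 0 := mul_ne_zero hz hq0
  have lower_z := baileySum_thetaTerm_lower_right hq hq0 (z * q) z (N + 1) N
  have lower_one := baileySum_thetaTerm_lower_right hq hq0 (z * q) 1 (N + 1) N
  have reflect_zq := baileySum_thetaTerm_neg q hp0 (z * q) (N + 1) (N + 1)
  have reflect_q := baileySum_thetaTerm_neg q hp0 q (N + 1) (N + 1)
  rw [div_self hp0] at reflect_zq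
  rw [mul_div_cancel_right₀ z hq0] at reflect_q
  rw [baileySum_thetaTerm_one_eq_zero, one_mul, reflect_q] at lower_one
  rw [reflect_zq] at lower_z
  rw [← zpow_natCast q 2, ← zpow_mul, Nat.cast_two, two_mul (N + 1), zpow_add₀ hq0]
  linear_combination lower_z + q ^ (N + 1) * lower_one

theorem baileySum_thetaTerm_cube {s : ℂ} (hs : ¬IsOfFinOrder s) (hs0 : s ≠ 0) (N : ℕ) :
    baileySum (s ^ 2) (thetaTerm (s ^ 3) (s ^ 2)) N N =
      (qPoch (-s) (s ^ 2) N * qPoch ((s ^ 2) ^ 2) ((s ^ 2) ^ 2) N)⁻¹ := by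
  have hq : ¬IsOfFinOrder (s ^ 2) := fun h => hs (h.of_pow two_ne_zero)
  have hq0 : s ^ 2 ≠ 0 := pow_ne_zero 2 hs0
  rw [baileySum_thetaTerm_neg _ (pow_ne_zero 3 hs0), show s ^ 3 / s ^ 2 = s by field_simp,
    show s ^ 3 = s * s ^ 2 by ring]
  refine eq_inv_of_mul_eq_one_right ?_
  induction N with
  | zero => simp [baileySum_zero_zero, thetaTerm_zero, qPoch]
  | succ N ih =>
    have recurrence := baileySum_thetaTerm_sqrt_lower_left hs hs0 (s * s ^ 2) N
    rw [baileySum_thetaTerm_mul_lower_right hq hq0 hs0, zpow_add_one₀ (pow_ne_zero 2 hq0),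
      zpow_natCast, zpow_natCast] at recurrence
    rw [recurrence] at ih
    rw [qPoch_succ, qPoch_succ, Nat.cast_add_one]
    linear_combination ih

theorem bailey_step_thetaTerm (hq : ¬IsOfFinOrder q) (hq0 : q ≠ 0) (p z : ℂ) (N : ℕ) :
    ∑ M ∈ Finset.range (N + 1), q ^ M ^ 2 * invQPoch q (N - M) *
        baileySum q (thetaTerm p z) M M =
      baileySum q (thetaTerm (p * q ^ 2) (z * q)) N N := by
  have h := bailey_lemma hq hq0 zero_le_one (thetaTerm p z) N
  simp only [zpow_mul_thetaTerm hq0] at h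
  simp only [add_zero, sub_zero, zpow_one, ← sq] at h
  exact_mod_cast h

theorem bailey_step_thetaTerm_self (hq : ¬IsOfFinOrder q) (hq0 : q ≠ 0) (p : ℂ) (N : ℕ) :
    ∑ M ∈ Finset.range (N + 1), q ^ (M ^ 2 + M) * invQPoch q (N - M) *
        baileySum q (thetaTerm p q) M M =
      baileySum q (thetaTerm (p * q ^ 2) q) N N := by
  have h := bailey_lemma hq hq0 le_rfl (thetaTerm p q) N
  simp only [zpow_mul_thetaTerm hq0, sub_self, zpow_zero, mul_one, mul_add, ← sq,
    ← baileySum_thetaTerm_self_succ hq hq0] at h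
  exact_mod_cast h

end BaileyPair

section Tuple

@[to_additive]
theorem prod_Icc_succ_succ {α : Type*} [CommMonoid α] (f : ℕ → α) (j k : ℕ) :
    ∏ l ∈ Finset.Icc (j + 1) (k + 1), f l = ∏ l ∈ Finset.Icc j k, f (l + 1) := by
  rw [← Finset.map_add_right_Icc, Finset.prod_map]
  rfl

@[to_additive]
theorem prod_Icc_succ_eq_mul {α : Type*} [CommMonoid α] (f : ℕ → α) (k : ℕ) :
    ∏ j ∈ Finset.Icc 1 (k + 1), f j = f 1 * ∏ j ∈ Finset.Icc 1 k, f (j + 1) := by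
  rw [← Finset.mul_prod_Ioc_eq_prod_Icc (Nat.le_add_left 1 k), ← Finset.Icc_add_one_left_eq_Ioc,
    prod_Icc_succ_succ]

variable {k : ℕ}

theorem entry_cons_one (a : ℕ) (n : Fin k → ℕ) :
    entry (Fin.cons a n : Fin (k + 1) → ℕ) 1 = a := by
  simp [entry]

theorem entry_cons_succ (a : ℕ) (n : Fin k → ℕ) {j : ℕ} (hj : 1 ≤ j) :
    entry (Fin.cons a n : Fin (k + 1) → ℕ) (j + 1) = entry n j := by
  obtain ⟨j, rfl⟩ := Nat.exists_eq_add_of_le' hj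
  by_cases h : j + 1 ≤ k
  · rw [entry, entry, dif_pos (by omega), dif_pos (by omega)]
    exact Fin.cons_succ (α := fun _ => ℕ) a n ⟨j, h⟩
  · rw [entry, entry, dif_neg (by omega), dif_neg (by omega)]

theorem tailSum_cons_one (a : ℕ) (n : Fin k → ℕ) :
    tailSum (Fin.cons a n : Fin (k + 1) → ℕ) 1 = a + tailSum n 1 := by
  rw [tailSum, sum_Icc_succ_eq_add, entry_cons_one, tailSum]
  congr 1
  exact Finset.sum_congr rfl fun l hl => entry_cons_succ a n (Finset.mem_Icc.mp hl).1

theorem tailSum_cons_succ (a : ℕ) (n : Fin k → ℕ) {j : ℕ} (hj : 1 ≤ j) :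
    tailSum (Fin.cons a n : Fin (k + 1) → ℕ) (j + 1) = tailSum n j := by
  rw [tailSum, sum_Icc_succ_succ, tailSum]
  exact Finset.sum_congr rfl fun l hl =>
    entry_cons_succ a n (hj.trans (Finset.mem_Icc.mp hl).1)

theorem tailSum_one_eq_zero {n : Fin k → ℕ} (h : tailSum n 1 = 0) : n = 0 := by
  funext j
  have hj := Finset.sum_eq_zero_iff.mp h (j + 1) (Finset.mem_Icc.mpr ⟨by omega, by omega⟩)
  rw [entry, dif_pos (by omega)] at hj
  simpa using hj

theorem sum_Icc_tailSum_cons {α : Type*} [AddCommMonoid α] (f : ℕ → α) (a : ℕ) {i : ℕ}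
    (hi : 1 ≤ i) (n : Fin k → ℕ) :
    ∑ j ∈ Finset.Icc (i + 1) (k + 1), f (tailSum (Fin.cons a n : Fin (k + 1) → ℕ) j) =
      ∑ j ∈ Finset.Icc i k, f (tailSum n j) := by
  rw [sum_Icc_succ_succ]
  exact Finset.sum_congr rfl fun l hl => by
    rw [tailSum_cons_succ a n (hi.trans (Finset.mem_Icc.mp hl).1)]

theorem sum_Icc_one_tailSum_cons {α : Type*} [AddCommMonoid α] (f : ℕ → α) (a : ℕ)
    (n : Fin k → ℕ) :
    ∑ j ∈ Finset.Icc 1 (k + 1), f (tailSum (Fin.cons a n : Fin (k + 1) → ℕ) j) =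
      f (a + tailSum n 1) + ∑ j ∈ Finset.Icc 1 k, f (tailSum n j) := by
  rw [sum_Icc_succ_eq_add, tailSum_cons_one, ← sum_Icc_tailSum_cons f a le_rfl, sum_Icc_succ_succ]

theorem sumExponent_one_cons (a : ℕ) (n : Fin k → ℕ) :
    sumExponent 1 (Fin.cons a n : Fin (k + 1) → ℕ) =
      (a + tailSum n 1) ^ 2 + (a + tailSum n 1) + sumExponent 1 n := by
  rw [sumExponent, sum_Icc_one_tailSum_cons (· ^ 2), sum_Icc_one_tailSum_cons (·), sumExponent]
  ring

theorem sumExponent_succ_cons {i : ℕ} (hi : 1 ≤ i) (a : ℕ) (n : Fin k → ℕ) :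
    sumExponent (i + 1) (Fin.cons a n : Fin (k + 1) → ℕ) =
      (a + tailSum n 1) ^ 2 + sumExponent i n := by
  rw [sumExponent, sum_Icc_one_tailSum_cons (· ^ 2), sum_Icc_tailSum_cons (·) a hi, sumExponent,
    add_assoc]

theorem tailSum_one_le_sumExponent (hk : 1 ≤ k) (i : ℕ) (n : Fin k → ℕ) :
    tailSum n 1 ≤ sumExponent i n :=
  calc tailSum n 1 ≤ tailSum n 1 ^ 2 := Nat.le_self_pow two_ne_zero _
    _ ≤ ∑ j ∈ Finset.Icc 1 k, tailSum n j ^ 2 :=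
      Finset.single_le_sum (f := fun j => tailSum n j ^ 2) (fun _ _ => Nat.zero_le _)
        (Finset.mem_Icc.mpr ⟨le_rfl, hk⟩)
    _ ≤ sumExponent i n := Nat.le_add_right _ _

theorem sumDenominator_cons (q s : ℂ) (a : ℕ) (n : Fin (k + 1) → ℕ) :
    sumDenominator q s (Fin.cons a n : Fin (k + 1 + 1) → ℕ) =
      qPoch q q a * sumDenominator q s n := by
  simp only [sumDenominator, Nat.add_sub_cancel]
  rw [prod_Icc_succ_eq_mul, entry_cons_one, entry_cons_succ a n (Nat.le_add_left 1 k),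
    Finset.prod_congr rfl fun l hl => by rw [entry_cons_succ a n (Finset.mem_Icc.mp hl).1]]
  ring

theorem hasSum_fin_succ_iff {α : Type*} [AddCommMonoid α] [TopologicalSpace α]
    {f : (Fin (k + 1) → ℕ) → α} {c : α} :
    HasSum f c ↔ HasSum (fun x : ℕ × (Fin k → ℕ) => f (Fin.cons x.1 x.2)) c :=
  ((Fin.consEquiv fun _ : Fin (k + 1) => ℕ).hasSum_iff (f := f)).symm

theorem summable_pow_tailSum {ρ : ℝ} (h0 : 0 ≤ ρ) (h1 : ρ < 1) (k : ℕ) :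
    Summable fun n : Fin k → ℕ => ρ ^ tailSum n 1 := by
  induction k with
  | zero => exact Summable.of_finite
  | succ k ih =>
    obtain ⟨c, hc⟩ := (summable_geometric_of_lt_one h0 h1).mul_of_nonneg ih
      (fun n => pow_nonneg h0 n) (fun n => pow_nonneg h0 _)
    refine ⟨c, hasSum_fin_succ_iff.mpr ?_⟩
    simpa only [tailSum_cons_one, pow_add] using hc

end Tuple

section NestedSum

variable {ι X α : Type*} [AddCommMonoid α] [TopologicalSpace α]

theorem hasSum_prod_of_finite_support [ContinuousAdd α] {φ : ι × X → α}
    {g : ι → α} {t : Finset ι} (hφ : ∀ m ∈ t, HasSum (fun x => φ (m, x)) (g m))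
    (ht : ∀ m ∉ t, ∀ x, φ (m, x) = 0) :
    HasSum φ (∑ m ∈ t, g m) := by
  classical
  have fibre : ∀ m ∈ t, HasSum (fun y : ι × X => if y.1 = m then φ y else 0) (g m) := by
    intro m hm
    refine ((Prod.mk_right_injective m).hasSum_iff ?_).mp ?_
    · rintro ⟨m', x⟩ hx
      exact if_neg fun h => hx ⟨x, by rw [← h]⟩
    · simpa [Function.comp_def] using hφ m hm
  refine (hasSum_sum fibre).congr_fun ?_
  rintro ⟨m, x⟩
  rw [Finset.sum_ite_eq]
  split_ifs with hm
  · rfl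
  · exact ht m hm x

theorem hasSum_shear_iff {ν : X → ℕ} {φ : ℕ × X → α} (hφ : ∀ m x, m < ν x → φ (m, x) = 0)
    {c : α} :
    HasSum (fun y : ℕ × X => φ (y.1 + ν y.2, y.2)) c ↔ HasSum φ c := by
  have shear_injective : Function.Injective fun y : ℕ × X => (y.1 + ν y.2, y.2) := by
    rintro ⟨a, x⟩ ⟨b, y⟩ h
    obtain ⟨hab, rfl⟩ := Prod.mk.inj h
    exact Prod.ext (Nat.add_right_cancel hab) rfl
  refine shear_injective.hasSum_iff ?_
  rintro ⟨m, x⟩ hmx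
  refine hφ m x (lt_of_not_ge fun h => hmx ⟨(m - ν x, x), ?_⟩)
  simp only [Nat.sub_add_cancel h]

theorem hasSum_invQPoch_nested {q : ℂ} {T : X → ℂ} {ν : X → ℕ} {V : ℕ → ℂ} (f : ℕ → ℂ) (N : ℕ)
    (hV : ∀ M : ℕ, HasSum (fun x => T x * invQPoch q (M - ν x)) (V M)) :
    HasSum (fun y : ℕ × X => f (y.1 + ν y.2) * (invQPoch q y.1 * T y.2) *
        invQPoch q (N - (y.1 + ν y.2 : ℕ)))
      (∑ M ∈ Finset.range (N + 1), f M * invQPoch q (N - M) * V M) := by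
  have unsheared : HasSum (fun y : ℕ × X => f y.1 * invQPoch q (N - y.1) *
      (T y.2 * invQPoch q (y.1 - ν y.2)))
      (∑ M ∈ Finset.range (N + 1), f M * invQPoch q (N - M) * V M) := by
    refine hasSum_prod_of_finite_support
      (fun M _ => (hV M).mul_left (f M * invQPoch q (N - M))) fun M hM x => ?_
    rw [Finset.mem_range] at hM
    rw [invQPoch_of_neg q (by omega : (N : ℤ) - M < 0), mul_zero, zero_mul]
  refine ((hasSum_shear_iff (ν := ν) fun M x hM => ?_).mpr unsheared).congr_fun fun y => ?_
  · rw [invQPoch_of_neg q (by omega : (M : ℤ) - ν x < 0), mul_zero, mul_zero]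
  · rw [Nat.cast_add, add_sub_cancel_right]
    ring

end NestedSum

section Multisum

variable {q s : ℂ} {k : ℕ}

/-- The summand of the Andrews–Gordon type multisum, with `s` in the role of `q^{1/2}`. -/
noncomputable def multisumTerm (q s : ℂ) (i : ℕ) (n : Fin k → ℕ) : ℂ :=
  q ^ sumExponent i n / sumDenominator q s n

theorem multisumTerm_one_cons (q s : ℂ) (a : ℕ) (n : Fin (k + 1) → ℕ) :
    multisumTerm q s 1 (Fin.cons a n : Fin (k + 1 + 1) → ℕ) =
      q ^ ((a + tailSum n 1) ^ 2 + (a + tailSum n 1)) *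
        (invQPoch q a * multisumTerm q s 1 n) := by
  rw [multisumTerm, sumExponent_one_cons, sumDenominator_cons, pow_add q (_ + _), invQPoch_natCast,
    multisumTerm]
  ring

theorem multisumTerm_succ_cons (q s : ℂ) {i : ℕ} (hi : 1 ≤ i) (a : ℕ) (n : Fin (k + 1) → ℕ) :
    multisumTerm q s (i + 1) (Fin.cons a n : Fin (k + 1 + 1) → ℕ) =
      q ^ (a + tailSum n 1) ^ 2 * (invQPoch q a * multisumTerm q s i n) := by
  rw [multisumTerm, sumExponent_succ_cons hi, sumDenominator_cons, pow_add, invQPoch_natCast,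
    multisumTerm]
  ring

theorem hasSum_multisumTerm_cons {i j : ℕ} {f V : ℕ → ℂ} (N : ℕ)
    (hcons : ∀ a (n : Fin (k + 1) → ℕ), multisumTerm q s i (Fin.cons a n : Fin (k + 1 + 1) → ℕ) =
      f (a + tailSum n 1) * (invQPoch q a * multisumTerm q s j n))
    (hV : ∀ M : ℕ, HasSum (fun n : Fin (k + 1) → ℕ =>
      multisumTerm q s j n * invQPoch q (M - tailSum n 1)) (V M)) :
    HasSum (fun n : Fin (k + 2) → ℕ => multisumTerm q s i n * invQPoch q (N - tailSum n 1))
      (∑ M ∈ Finset.range (N + 1), f M * invQPoch q (N - M) * V M) := by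
  rw [hasSum_fin_succ_iff]
  simpa only [hcons, tailSum_cons_one] using hasSum_invQPoch_nested f N hV

theorem hasSum_multisumTerm_fin_one {i : ℕ} {e : ℕ → ℕ} (N : ℕ)
    (he : ∀ m, sumExponent i (fun _ : Fin 1 => m) = e m) :
    HasSum (fun n : Fin 1 → ℕ => multisumTerm q s i n * invQPoch q (N - tailSum n 1))
      (∑ M ∈ Finset.range (N + 1), q ^ e M * invQPoch q (N - M) *
        (qPoch (-s) q M * qPoch (q ^ 2) (q ^ 2) M)⁻¹) := by
  rw [← (Equiv.funUnique (Fin 1) ℕ).symm.hasSum_iff]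
  have term_eq : ∀ m : ℕ, multisumTerm q s i (fun _ : Fin 1 => m) *
      invQPoch q (N - tailSum (fun _ : Fin 1 => m) 1) =
      q ^ e m * invQPoch q (N - m) * (qPoch (-s) q m * qPoch (q ^ 2) (q ^ 2) m)⁻¹ := by
    intro m
    have tailSum_eq : tailSum (fun _ : Fin 1 => m) 1 = m := by simp [tailSum, entry]
    have denominator_eq : sumDenominator q s (fun _ : Fin 1 => m) =
        qPoch (-s) q m * qPoch (q ^ 2) (q ^ 2) m := by simp [sumDenominator, entry]
    rw [multisumTerm, he, tailSum_eq, denominator_eq, div_eq_mul_inv, mul_right_comm]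
  refine HasSum.congr_fun (hasSum_sum_of_ne_finset_zero fun m hm => ?_) term_eq
  rw [Finset.mem_range] at hm
  rw [invQPoch_of_neg q (by omega : (N : ℤ) - m < 0), mul_zero, zero_mul]

theorem hasSum_truncated_multisum (hs : ¬IsOfFinOrder s) (hs0 : s ≠ 0) (k : ℕ) {i : ℕ}
    (hi : 1 ≤ i) (hik : i ≤ k + 2) (N : ℕ) :
    HasSum (fun n : Fin (k + 1) → ℕ =>
        multisumTerm (s ^ 2) s i n * invQPoch (s ^ 2) (N - tailSum n 1))
      (baileySum (s ^ 2) (thetaTerm (s ^ (3 + 4 * (k + 1))) ((s ^ 2) ^ i)) N N) := by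
  have hq : ¬IsOfFinOrder (s ^ 2) := fun h => hs (h.of_pow two_ne_zero)
  have hq0 : s ^ 2 ≠ 0 := pow_ne_zero 2 hs0
  have base_succ (k : ℕ) : s ^ (3 + 4 * (k + 1)) = s ^ (3 + 4 * k) * (s ^ 2) ^ 2 := by ring
  rw [base_succ]
  obtain ⟨j, rfl⟩ := Nat.exists_eq_add_of_le' hi
  induction k generalizing j N with
  | zero =>
    simp only [mul_zero, add_zero]
    obtain rfl | rfl : j = 0 ∨ j = 1 := by omega
    · rw [zero_add, pow_one, ← bailey_step_thetaTerm_self hq hq0]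
      simp only [baileySum_thetaTerm_cube hs hs0]
      exact hasSum_multisumTerm_fin_one N fun m => by simp [sumExponent, tailSum, entry]
    · have step := bailey_step_thetaTerm hq hq0 (s ^ 3) (s ^ 2) N
      rw [← sq (s ^ 2)] at step
      rw [one_add_one_eq_two, ← step]
      simp only [baileySum_thetaTerm_cube hs hs0]
      exact hasSum_multisumTerm_fin_one N fun m => by simp [sumExponent, tailSum, entry]
  | succ k ih =>
    rw [base_succ]
    cases j with
    | zero =>
      rw [zero_add, pow_one, ← bailey_step_thetaTerm_self hq hq0]
      have ih_one := fun M => ih M 0 le_rfl (by omega)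
      rw [zero_add, pow_one] at ih_one
      exact hasSum_multisumTerm_cons (f := fun M => (s ^ 2) ^ (M ^ 2 + M)) N
        (multisumTerm_one_cons _ _) ih_one
    | succ j =>
      rw [pow_succ (s ^ 2) (j + 1), ← bailey_step_thetaTerm hq hq0]
      exact hasSum_multisumTerm_cons (f := fun M => (s ^ 2) ^ M ^ 2) N
        (multisumTerm_succ_cons _ _ (Nat.le_add_left 1 j))
        fun M => ih M j (Nat.le_add_left 1 j) (by omega)

theorem exists_norm_inv_sumDenominator_le (hq : ‖q‖ < 1) (hs : ‖s‖ < 1) (k : ℕ) :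
    ∃ K : ℝ, ∀ n : Fin k → ℕ, ‖(sumDenominator q s n)⁻¹‖ ≤ K := by
  have hq2 : ‖q ^ 2‖ < 1 := by
    rw [norm_pow]
    exact pow_lt_one₀ (norm_nonneg q) hq two_ne_zero
  obtain ⟨K₁, hK₁⟩ := exists_norm_inv_qPoch_le hq hq
  obtain ⟨K₂, hK₂⟩ := exists_norm_inv_qPoch_le (a := -s) (by rwa [norm_neg]) hq
  obtain ⟨K₃, hK₃⟩ := exists_norm_inv_qPoch_le hq2 hq2
  have hK₁0 : 0 ≤ K₁ := (norm_nonneg _).trans (hK₁ 0)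
  have hK₂0 : 0 ≤ K₂ := (norm_nonneg _).trans (hK₂ 0)
  refine ⟨(∏ _j ∈ Finset.Icc 1 (k - 1), K₁) * K₂ * K₃, fun n => ?_⟩
  rw [sumDenominator, mul_inv, mul_inv, norm_mul, norm_mul, ← Finset.prod_inv_distrib, norm_prod]
  gcongr
  · exact hK₁ _
  · exact hK₂ _
  · exact hK₃ _

theorem summable_norm_multisumTerm (hq : ‖q‖ < 1) (hs : ‖s‖ < 1) (hk : 1 ≤ k) (i : ℕ) :
    Summable fun n : Fin k → ℕ => ‖multisumTerm q s i n‖ := by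
  obtain ⟨K, hK⟩ := exists_norm_inv_sumDenominator_le hq hs k
  refine ((summable_pow_tailSum (norm_nonneg q) hq k).mul_right K).of_nonneg_of_le
    (fun _ => norm_nonneg _) fun n => ?_
  rw [multisumTerm, div_eq_mul_inv, norm_mul, norm_pow]
  exact mul_le_mul (pow_le_pow_of_le_one (norm_nonneg _) hq.le (tailSum_one_le_sumExponent hk i n))
    (hK n) (norm_nonneg _) (pow_nonneg (norm_nonneg _) _)

theorem tendsto_truncated_multisum (hq : ‖q‖ < 1) (hs : ‖s‖ < 1) (hk : 1 ≤ k) (i : ℕ) :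
    Tendsto (fun N : ℕ => ∑' n : Fin k → ℕ, multisumTerm q s i n * invQPoch q (N - tailSum n 1))
      atTop (𝓝 ((∑' n : Fin k → ℕ, multisumTerm q s i n) * (qPochInf q q)⁻¹)) := by
  obtain ⟨K, hK⟩ := exists_norm_invQPoch_le hq
  rw [← tsum_mul_right]
  refine tendsto_tsum_of_dominated_convergence
    ((summable_norm_multisumTerm hq hs hk i).mul_right K) (fun n => ?_)
    (Eventually.of_forall fun N n => ?_)
  · exact (tendsto_invQPoch_natCast_add hq (-tailSum n 1)).const_mul _
  · rw [norm_mul]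
    exact mul_le_mul_of_nonneg_left (hK _) (norm_nonneg _)

theorem hasSum_multisumTerm (hs : ‖s‖ < 1) (hs0 : s ≠ 0) (hk : 1 ≤ k) {i : ℕ} (hi : 1 ≤ i)
    (hik : i ≤ k + 1) :
    HasSum (fun n : Fin k → ℕ => multisumTerm (s ^ 2) s i n)
      ((∑' r, thetaTerm (s ^ (3 + 4 * k)) ((s ^ 2) ^ i) r) / qPochInf (s ^ 2) (s ^ 2)) := by
  obtain ⟨k, rfl⟩ := Nat.exists_eq_add_of_le' hk
  have norm_pow_lt_one : ∀ {m : ℕ}, m ≠ 0 → ‖s ^ m‖ < 1 := fun hm => by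
    rw [norm_pow]
    exact pow_lt_one₀ (norm_nonneg s) hs hm
  have hq : ‖s ^ 2‖ < 1 := norm_pow_lt_one two_ne_zero
  have truncated := hasSum_truncated_multisum (not_isOfFinOrder_of_norm_lt_one hs) hs0 k hi hik
  have limits_eq := tendsto_nhds_unique
    ((tendsto_truncated_multisum hq hs hk i).congr fun N => (truncated N).tsum_eq)
    (tendsto_baileySum hq (summable_thetaTerm (pow_ne_zero _ hs0) (norm_pow_lt_one (by omega))
      (pow_ne_zero i (pow_ne_zero 2 hs0))))
  rw [← mul_assoc] at limits_eq
  rw [div_eq_mul_inv, ← mul_right_cancel₀ (inv_ne_zero (qPochInf_ne_zero hq hq)) limits_eq]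
  exact (summable_norm_multisumTerm hq hs hk i).of_norm.hasSum

theorem hasSum_multisumTerm_zero (hk : 1 ≤ k) (s : ℂ) (i : ℕ) :
    HasSum (fun n : Fin k → ℕ => multisumTerm 0 s i n) 1 := by
  convert hasSum_single (0 : Fin k → ℕ) fun n hn => ?_ using 1
  · simp [multisumTerm, sumExponent, sumDenominator, tailSum, entry, qPoch]
  · rw [multisumTerm, zero_pow, zero_div]
    exact fun h => hn (tailSum_one_eq_zero
      (Nat.le_zero.mp ((tailSum_one_le_sumExponent hk i n).trans_eq h)))

end Multisum

theorem theorem1p1 (k i : ℕ) (hk : 1 ≤ k) (hi : 1 ≤ i) (hik : i ≤ k + 1)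
    (q s : ℂ) (hq : ‖q‖ < 1) (hs : s ^ 2 = q) :
    HasSum (fun n : Fin k → ℕ => q ^ sumExponent i n / sumDenominator q s n)
      (qPochInf (q ^ i) (s ^ (3 + 4 * k)) *
          qPochInf (s ^ (3 + 4 * k - 2 * i)) (s ^ (3 + 4 * k)) *
          qPochInf (s ^ (3 + 4 * k)) (s ^ (3 + 4 * k)) /
        qPochInf q q) := by
  subst hs
  rcases eq_or_ne s 0 with rfl | hs0
  · rw [zero_pow two_ne_zero, zero_pow (by omega : i ≠ 0),
      zero_pow (by omega : 3 + 4 * k - 2 * i ≠ 0), zero_pow (by omega : 3 + 4 * k ≠ 0)]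
    simp only [qPochInf_zero_left, mul_one, div_one]
    exact hasSum_multisumTerm_zero hk 0 i
  · have hs : ‖s‖ < 1 := by
      rwa [norm_pow, pow_lt_one_iff_of_nonneg (norm_nonneg s) two_ne_zero] at hq
    have hp : ‖s ^ (3 + 4 * k)‖ < 1 := by
      rw [norm_pow]
      exact pow_lt_one₀ (norm_nonneg s) hs (by omega)
    have triple_product := jacobi_triple_product hp (pow_ne_zero _ hs0)
      (pow_ne_zero i (pow_ne_zero 2 hs0))
    rw [← pow_mul s 2 i, div_eq_mul_inv,
      ← pow_sub₀ s hs0 (by omega)] at triple_product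
    rw [← pow_mul s 2 i, ← triple_product, pow_mul]
    exact hasSum_multisumTerm hs hs0 hk hi hik
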